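/- Let $n\ge 0$ and $t,u\in\mathbb{C}$. Let $\ddot{H}$ be the odd double affine Hecke algebra of type $A_{n-1}$ (of the symmetric group $S_n$), that is, the associative unital $\mathbb{C}$-algebra generated by $\xi_1,\dots,\xi_n,\eta_1,\dots,\eta_n$ and the group algebra $\mathbb{C}S_n$, subject to the relations $$\eta_i\eta_j=-\eta_j\eta_i,\qquad \xi_i\xi_j=-\xi_j\xi_i\qquad(i\ne j),$$ $$\sigma\xi_j=\xi_{\sigma(j)}\sigma,\qquad \sigma\eta_j=\eta_{\sigma(j)}\sigma\qquad(\sigma\in S_n,\ 1\le j\le n),$$ $$\eta_i\xi_j+\xi_j\eta_i=u\,s_{ij}\quad(i\neq j),\qquad \eta_i\xi_i+\xi_i\eta_i=t\cdot 1+u\sum_{k\ne i}s_{ki},$$ where $s_{ij}\in S_n$ is the transposition of $i$ and $j$. Put $s_i=s_{i,i+1}$ and $$\mathfrak z_i=-\xi_i\eta_i+u\sum_{k<i}s_{ki}\in\ddot H\qquad(1\le i\le n).$$ Then: 1. $\mathfrak z_i\mathfrak z_j=\mathfrak z_j\mathfrak z_i$ for all $i,j$. 2. $s_i\mathfrak z_i=\mathfrak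 z_{i+1}s_i-u$ for $1\le i\le n-1$, and $s_i\mathfrak z_j=\mathfrak z_js_i$ for $1\le i\le n-1$ and $j\ne i,i+1$. 3. The $\mathfrak z_i$ and $S_n$ generate a copy of the degenerate affine Hecke algebra of Drinfeld and Lusztig: let $H_n(u)$ be the associative unital $\mathbb{C}$-algebra generated by $x_1,\dots,x_n$ and $\mathbb{C}S_n$, subject to the relations $x_ix_j=x_jx_i$ for all $i,j$, $\ s_ix_i=x_{i+1}s_i-u$ for $1\le i\le n-1$, and $s_ix_j=x_js_i$ for $1\le i\le n-1$ and $j\ne i,i+1$. Then there is an isomorphism of $\mathbb{C}$-algebras from $H_n(u)$ onto the unital subalgebra of $\ddot H$ generated by $\mathfrak z_1,\dots,\mathfrak z_n$ and $S_n$, sending $x_i\mapsto\mathfrak z_i$ for $1\le i\le n$ and $\sigma\mapsto\sigma$ for $\sigma\in S_n$. -/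

import Mathlib

/-! ### The odd double affine Hecke algebra of type `A_{n-1}` -/

/-- Generators: `ξ_i`, `η_i` (`i : Fin n`) and the elements `σ` of the symmetric group. -/
inductive OddDaHaGen (n : ℕ) : Type
  | xi (i : Fin n) : OddDaHaGen n
  | eta (i : Fin n) : OddDaHaGen n
  | perm (σ : Equiv.Perm (Fin n)) : OddDaHaGen n

namespace OddDaHaGen

/-- The generator `ξ_i` in the free algebra. -/
abbrev fxi {n : ℕ} (i : Fin n) : FreeAlgebra ℂ (OddDaHaGen n) := FreeAlgebra.ι ℂ (xi i)

/-- The generator `η_i` in the free algebra. -/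
abbrev feta {n : ℕ} (i : Fin n) : FreeAlgebra ℂ (OddDaHaGen n) := FreeAlgebra.ι ℂ (eta i)

/-- The generator `σ` in the free algebra. -/
abbrev fperm {n : ℕ} (σ : Equiv.Perm (Fin n)) : FreeAlgebra ℂ (OddDaHaGen n) :=
  FreeAlgebra.ι ℂ (perm σ)

end OddDaHaGen

open OddDaHaGen in
/-- Defining relations; `perm_one` and `perm_mul` are the relations of the group algebra `ℂ S_n`. -/
inductive OddDaHaRel (n : ℕ) (t u : ℂ) :
    FreeAlgebra ℂ (OddDaHaGen n) → FreeAlgebra ℂ (OddDaHaGen n) → Prop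
  | perm_one : OddDaHaRel n t u (fperm 1) 1
  | perm_mul (σ τ : Equiv.Perm (Fin n)) :
      OddDaHaRel n t u (fperm (σ * τ)) (fperm σ * fperm τ)
  | eta_eta (i j : Fin n) (h : i ≠ j) :
      OddDaHaRel n t u (feta i * feta j) (-(feta j * feta i))
  | xi_xi (i j : Fin n) (h : i ≠ j) :
      OddDaHaRel n t u (fxi i * fxi j) (-(fxi j * fxi i))
  | perm_xi (σ : Equiv.Perm (Fin n)) (j : Fin n) :
      OddDaHaRel n t u (fperm σ * fxi j) (fxi (σ j) * fperm σ)
  | perm_eta (σ : Equiv.Perm (Fin n)) (j : Fin n) :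
      OddDaHaRel n t u (fperm σ * feta j) (feta (σ j) * fperm σ)
  | eta_xi_ne (i j : Fin n) (h : i ≠ j) :
      OddDaHaRel n t u (feta i * fxi j + fxi j * feta i) (u • fperm (Equiv.swap i j))
  | eta_xi_self (i : Fin n) :
      OddDaHaRel n t u (feta i * fxi i + fxi i * feta i)
        (t • 1 + u • ∑ k ∈ Finset.univ.filter (fun k => k ≠ i), fperm (Equiv.swap k i))

/-- The odd double affine Hecke algebra of the symmetric group `S_n` (type `A_{n-1}`) with
parameters `t`, `u`. -/
abbrev OddDaHa (n : ℕ) (t u : ℂ) : Type := RingQuot (OddDaHaRel n t u)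

namespace OddDaHa

/-- The element `ξ_i`. -/
noncomputable def xi {n : ℕ} (t u : ℂ) (i : Fin n) : OddDaHa n t u :=
  RingQuot.mkAlgHom ℂ (OddDaHaRel n t u) (OddDaHaGen.fxi i)

/-- The element `η_i`. -/
noncomputable def eta {n : ℕ} (t u : ℂ) (i : Fin n) : OddDaHa n t u :=
  RingQuot.mkAlgHom ℂ (OddDaHaRel n t u) (OddDaHaGen.feta i)

/-- The image of `σ ∈ S_n`. -/
noncomputable def perm {n : ℕ} (t u : ℂ) (σ : Equiv.Perm (Fin n)) : OddDaHa n t u :=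
  RingQuot.mkAlgHom ℂ (OddDaHaRel n t u) (OddDaHaGen.fperm σ)

/-- The element `z_i = -ξ_i η_i + u ∑_{k < i} s_{ki}`. -/
noncomputable def z {n : ℕ} (t u : ℂ) (i : Fin n) : OddDaHa n t u :=
  -(xi t u i * eta t u i) +
    u • ∑ k ∈ Finset.univ.filter (fun k => k < i), perm t u (Equiv.swap k i)

end OddDaHa

/-! ### The degenerate affine Hecke algebra of type `A_{n-1}` -/

/-- Generators: `x_i` (`i : Fin n`) and the elements `σ` of the symmetric group. -/
inductive DegAffHeckeGen (n : ℕ) : Type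
  | x (i : Fin n) : DegAffHeckeGen n
  | perm (σ : Equiv.Perm (Fin n)) : DegAffHeckeGen n

namespace DegAffHeckeGen

/-- The generator `x_i` in the free algebra. -/
abbrev fx {n : ℕ} (i : Fin n) : FreeAlgebra ℂ (DegAffHeckeGen n) := FreeAlgebra.ι ℂ (x i)

/-- The generator `σ` in the free algebra. -/
abbrev fperm {n : ℕ} (σ : Equiv.Perm (Fin n)) : FreeAlgebra ℂ (DegAffHeckeGen n) :=
  FreeAlgebra.ι ℂ (perm σ)

end DegAffHeckeGen

open DegAffHeckeGen in
/-- Defining relations. The simple reflection `s_i` is the transposition of `i` and `j = i + 1`. -/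
inductive DegAffHeckeRel (n : ℕ) (u : ℂ) :
    FreeAlgebra ℂ (DegAffHeckeGen n) → FreeAlgebra ℂ (DegAffHeckeGen n) → Prop
  | perm_one : DegAffHeckeRel n u (fperm 1) 1
  | perm_mul (σ τ : Equiv.Perm (Fin n)) :
      DegAffHeckeRel n u (fperm (σ * τ)) (fperm σ * fperm τ)
  | x_x (i j : Fin n) : DegAffHeckeRel n u (fx i * fx j) (fx j * fx i)
  | simple_x (i j : Fin n) (hij : j.val = i.val + 1) :
      DegAffHeckeRel n u (fperm (Equiv.swap i j) * fx i)
        (fx j * fperm (Equiv.swap i j) - u • 1)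
  | simple_x_of_ne (i j k : Fin n) (hij : j.val = i.val + 1) (hi : k ≠ i) (hj : k ≠ j) :
      DegAffHeckeRel n u (fperm (Equiv.swap i j) * fx k) (fx k * fperm (Equiv.swap i j))

/-- The degenerate affine Hecke algebra of type `A_{n-1}` (for `gl_n`) with parameter `u`. -/
abbrev DegAffHecke (n : ℕ) (u : ℂ) : Type := RingQuot (DegAffHeckeRel n u)

namespace DegAffHecke

/-- The element `x_i`. -/
noncomputable def x {n : ℕ} (u : ℂ) (i : Fin n) : DegAffHecke n u :=
  RingQuot.mkAlgHom ℂ (DegAffHeckeRel n u) (DegAffHeckeGen.fx i)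

/-- The image of `σ ∈ S_n`. -/
noncomputable def perm {n : ℕ} (u : ℂ) (σ : Equiv.Perm (Fin n)) : DegAffHecke n u :=
  RingQuot.mkAlgHom ℂ (DegAffHeckeRel n u) (DegAffHeckeGen.fperm σ)

end DegAffHecke

/-! The relations among the `z i` are direct computations. Write y_i = ξ_i η_i and let L_i be the
Jucys–Murphy element. For i < j the commutator [y_i, y_j] = u (y_i - y_j) s_ij is cancelled by u
[y_i, L_j], while L_i commutes with y_j and with L_j (`z_mul_z_of_lt`). The relations give a
homomorphism from `DegAffHecke n u` onto the subalgebra generated by the `z i` and S_n; the real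
content is its injectivity.

The monomials x^m σ span the Hecke algebra (`standardSpan_eq_top`), so it is enough that their
images z^m σ are linearly independent (`linearIndependent_zMonomial_mul_perm`). This is tested in a
representation `fockRep` on skew polynomials tensored with Clifford-valued functions on S_n: ξ_i
multiplies, S_n permutes, and η_i is an odd Dunkl operator plus a Clifford generator c_i. The
algebra puts no constraint on the squares of the η_i, so they may act invertibly on the vacuum
vectors.

The part -ξ_i c_i of z_i then raises the degree by one, and everything else in z_i leaves the degree
filtration stable. Hence z^m σ sends the vacuum to ± x^m tensored with a Clifford unit placed at σ,
up to lower degree. These leading terms are independent, and they do not involve t or u, so no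
genericity is needed. -/

namespace OddDaHa

variable {n : ℕ} (t u : ℂ)

/-- The ring structure on the odd double affine Hecke algebra whose underlying semiring structure
is syntactically the one that carries the `ℂ`-algebra structure. -/
@[reducible]
noncomputable def ring (n : ℕ) (t u : ℂ) : Ring (OddDaHa n t u) where
  toSemiring := RingQuot.instSemiring _
  neg := Neg.neg
  sub := Sub.sub
  sub_eq_add_neg a b := (RingQuot.instRing (OddDaHaRel n t u)).sub_eq_add_neg a b
  zsmul := zsmulRec
  intCast := Int.castDef
  intCast_ofNat _ := rfl
  intCast_negSucc _ := rfl
  neg_add_cancel a := (RingQuot.instRing (OddDaHaRel n t u)).neg_add_cancel a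

attribute [local instance] ring

/-! ### Relations in the odd algebra and the Hecke relations for the `z i`. -/

theorem perm_one : perm t u (1 : Equiv.Perm (Fin n)) = 1 := by
  simpa [perm] using RingQuot.mkAlgHom_rel ℂ (OddDaHaRel.perm_one (n := n) (t := t) (u := u))

theorem perm_mul (σ τ : Equiv.Perm (Fin n)) : perm t u (σ * τ) = perm t u σ * perm t u τ := by
  simpa [perm] using RingQuot.mkAlgHom_rel ℂ (OddDaHaRel.perm_mul (t := t) (u := u) σ τ)

theorem eta_mul_eta {i j : Fin n} (h : i ≠ j) :
    eta t u i * eta t u j = -(eta t u j * eta t u i) := by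
  simpa [eta] using RingQuot.mkAlgHom_rel ℂ (OddDaHaRel.eta_eta (t := t) (u := u) i j h)

theorem xi_mul_xi {i j : Fin n} (h : i ≠ j) :
    xi t u i * xi t u j = -(xi t u j * xi t u i) := by
  simpa [xi] using RingQuot.mkAlgHom_rel ℂ (OddDaHaRel.xi_xi (t := t) (u := u) i j h)

theorem perm_mul_xi (σ : Equiv.Perm (Fin n)) (j : Fin n) :
    perm t u σ * xi t u j = xi t u (σ j) * perm t u σ := by
  simpa [xi, perm] using RingQuot.mkAlgHom_rel ℂ (OddDaHaRel.perm_xi (t := t) (u := u) σ j)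

theorem perm_mul_eta (σ : Equiv.Perm (Fin n)) (j : Fin n) :
    perm t u σ * eta t u j = eta t u (σ j) * perm t u σ := by
  simpa [eta, perm] using RingQuot.mkAlgHom_rel ℂ (OddDaHaRel.perm_eta (t := t) (u := u) σ j)

theorem eta_mul_xi {i j : Fin n} (h : i ≠ j) :
    eta t u i * xi t u j = u • perm t u (Equiv.swap i j) - xi t u j * eta t u i := by
  rw [eq_sub_iff_add_eq]
  simpa [xi, eta, perm] using
    RingQuot.mkAlgHom_rel ℂ (OddDaHaRel.eta_xi_ne (t := t) (u := u) i j h)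

/-- The Jucys–Murphy element `∑_{k < i} s_{ki}`. -/
noncomputable def jucysMurphy (i : Fin n) : OddDaHa n t u :=
  ∑ k ∈ Finset.univ.filter (fun k => k < i), perm t u (Equiv.swap k i)

theorem z_eq (i : Fin n) : z t u i = -(xi t u i * eta t u i) + u • jucysMurphy t u i := rfl

theorem perm_mul_perm_swap (σ : Equiv.Perm (Fin n)) (i j : Fin n) :
    perm t u σ * perm t u (Equiv.swap i j) =
      perm t u (Equiv.swap (σ i) (σ j)) * perm t u σ := by
  rw [← perm_mul, ← perm_mul, Equiv.swap_apply_apply]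
  simp

theorem perm_swap_mul_self (i j : Fin n) :
    perm t u (Equiv.swap i j) * perm t u (Equiv.swap i j) = 1 := by
  rw [← perm_mul, Equiv.swap_mul_self, perm_one]

/-- The hypothesis makes `σ` a bijection from the indices below `j` to those below `σ j`, so
conjugation by `σ` matches the two sums term by term. -/
theorem perm_mul_jucysMurphy (σ : Equiv.Perm (Fin n)) (j : Fin n)
    (h : ∀ k, k < j ↔ σ k < σ j) :
    perm t u σ * jucysMurphy t u j = jucysMurphy t u (σ j) * perm t u σ := by
  rw [jucysMurphy, jucysMurphy, Finset.mul_sum, Finset.sum_mul]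
  refine Finset.sum_bij (fun k _ => σ k) ?_ ?_ ?_ ?_
  · intro k hk
    simpa using (h k).1 (by simpa using hk)
  · intro a _ b _ hab
    exact σ.injective hab
  · intro b hb
    refine ⟨σ.symm b, ?_, by simp⟩
    have hb' : b < σ j := by simpa using hb
    simpa using (h (σ.symm b)).2 (by simpa using hb')
  · intro k _
    exact perm_mul_perm_swap t u σ k j

theorem perm_mul_xi_mul_eta (σ : Equiv.Perm (Fin n)) (j : Fin n) :
    perm t u σ * (xi t u j * eta t u j) = xi t u (σ j) * eta t u (σ j) * perm t u σ := by
  rw [← mul_assoc, perm_mul_xi, mul_assoc, perm_mul_eta, mul_assoc]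

theorem perm_mul_z (σ : Equiv.Perm (Fin n)) (j : Fin n) (h : ∀ k, k < j ↔ σ k < σ j) :
    perm t u σ * z t u j = z t u (σ j) * perm t u σ := by
  rw [z_eq, z_eq, mul_add, add_mul, mul_neg, perm_mul_xi_mul_eta, mul_smul_comm,
    perm_mul_jucysMurphy t u σ j h, smul_mul_assoc, neg_mul]

theorem simple_mul_z_of_ne {i j k : Fin n} (hij : j.val = i.val + 1) (hi : k ≠ i) (hj : k ≠ j) :
    perm t u (Equiv.swap i j) * z t u k = z t u k * perm t u (Equiv.swap i j) := by
  have hk : Equiv.swap i j k = k := Equiv.swap_apply_of_ne_of_ne hi hj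
  have := perm_mul_z t u (Equiv.swap i j) k (by
    intro l
    rw [hk]
    by_cases hli : l = i
    · subst hli; rw [Equiv.swap_apply_left]; simp only [Fin.lt_def, ne_eq, Fin.ext_iff] at *; omega
    by_cases hlj : l = j
    · subst hlj; rw [Equiv.swap_apply_right]; simp only [Fin.lt_def, ne_eq, Fin.ext_iff] at *; omega
    rw [Equiv.swap_apply_of_ne_of_ne hli hlj])
  rwa [hk] at this

theorem simple_mul_z {i j : Fin n} (hij : j.val = i.val + 1) :
    perm t u (Equiv.swap i j) * z t u i =
      z t u j * perm t u (Equiv.swap i j) - u • 1 := by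
  have hJ : perm t u (Equiv.swap i j) * jucysMurphy t u i =
      jucysMurphy t u j * perm t u (Equiv.swap i j) - 1 := by
    -- The sum for `j = i + 1` has one extra term, k = i; it contributes s_ij² = 1, the source of
    -- the constant -u.
    have hf : Finset.univ.filter (fun k => k < j) =
        insert i (Finset.univ.filter (fun k => k < i)) := by
      ext k
      simp only [Finset.mem_filter, Finset.mem_univ, true_and, Finset.mem_insert, Fin.lt_def,
        Fin.ext_iff]
      omega
    rw [jucysMurphy, jucysMurphy, hf, Finset.sum_insert (by simp), add_mul, perm_swap_mul_self,
      add_sub_cancel_left, Finset.mul_sum, Finset.sum_mul]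
    refine Finset.sum_congr rfl fun k hk => ?_
    have hki : k < i := by simpa using hk
    rw [perm_mul_perm_swap, Equiv.swap_apply_left, Equiv.swap_apply_of_ne_of_ne hki.ne]
    rintro rfl
    simp only [Fin.lt_def] at hki
    omega
  rw [z_eq, z_eq, mul_add, add_mul, mul_neg, perm_mul_xi_mul_eta, mul_smul_comm, hJ,
    Equiv.swap_apply_left, smul_mul_assoc, neg_mul, smul_sub, add_sub_assoc]

/-- Moving η past ξ in each product yields a term with s_ij and a term ξξηη; the ξξηη terms agree
because the signs from the ξ's and the η's cancel. -/
theorem commutator_xi_mul_eta {i j : Fin n} (h : i ≠ j) :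
    xi t u i * eta t u i * (xi t u j * eta t u j) - xi t u j * eta t u j * (xi t u i * eta t u i) =
      u • ((xi t u i * eta t u i - xi t u j * eta t u j) * perm t u (Equiv.swap i j)) := by
  have h1 : xi t u i * eta t u i * (xi t u j * eta t u j) =
      u • (xi t u i * eta t u i * perm t u (Equiv.swap i j)) -
        xi t u i * xi t u j * (eta t u i * eta t u j) := by
    rw [mul_assoc, ← mul_assoc (eta t u i), eta_mul_xi t u h, sub_mul, mul_sub, smul_mul_assoc,
      perm_mul_eta, Equiv.swap_apply_right, mul_smul_comm]
    simp only [mul_assoc]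
  have h2 : xi t u j * eta t u j * (xi t u i * eta t u i) =
      u • (xi t u j * eta t u j * perm t u (Equiv.swap i j)) -
        xi t u j * xi t u i * (eta t u j * eta t u i) := by
    rw [mul_assoc, ← mul_assoc (eta t u j), eta_mul_xi t u h.symm, sub_mul, mul_sub,
      smul_mul_assoc, perm_mul_eta, Equiv.swap_apply_right, mul_smul_comm, Equiv.swap_comm]
    simp only [mul_assoc]
  rw [h1, h2, xi_mul_xi t u h, eta_mul_eta t u h, neg_mul_neg, sub_mul, smul_sub]
  abel

theorem z_mul_z_of_lt {i j : Fin n} (h : i < j) : z t u i * z t u j = z t u j * z t u i := by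
  set y : Fin n → OddDaHa n t u := fun k => xi t u k * eta t u k with hy
  set s := perm t u (Equiv.swap i j)
  have hyy : y i * y j - y j * y i = u • ((y i - y j) * s) := commutator_xi_mul_eta t u h.ne
  have hfix : ∀ k < i, ∀ l, i < l → Equiv.swap k i l = l := fun k hk l hl =>
    Equiv.swap_apply_of_ne_of_ne (hk.trans hl).ne' hl.ne'
  have hLj : jucysMurphy t u i * y j = y j * jucysMurphy t u i := by
    rw [jucysMurphy, Finset.mul_sum, Finset.sum_mul]
    refine Finset.sum_congr rfl fun k hk => ?_
    rw [hy, perm_mul_xi_mul_eta, hfix k (by simpa using hk) j h]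
  have hLL : jucysMurphy t u i * jucysMurphy t u j = jucysMurphy t u j * jucysMurphy t u i := by
    conv_lhs => rw [jucysMurphy, Finset.sum_mul]
    conv_rhs => enter [2]; rw [jucysMurphy]
    rw [Finset.mul_sum]
    refine Finset.sum_congr rfl fun k hk => ?_
    have hk : k < i := by simpa using hk
    have := perm_mul_jucysMurphy t u (Equiv.swap k i) j (by
      intro l
      rw [hfix k hk j h]
      by_cases hlk : l = k
      · subst hlk; rw [Equiv.swap_apply_left]; exact ⟨fun _ => h, fun _ => hk.trans h⟩
      by_cases hli : l = i
      · subst hli; rw [Equiv.swap_apply_right]; exact ⟨fun _ => hk.trans h, fun _ => h⟩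
      rw [Equiv.swap_apply_of_ne_of_ne hlk hli])
    rwa [hfix k hk j h] at this
  -- Only the summand s_ij moves the index `i`; every other s_kj in L_j commutes with y_i.
  have hyL : y i * jucysMurphy t u j - jucysMurphy t u j * y i = (y i - y j) * s := by
    rw [jucysMurphy, Finset.mul_sum, Finset.sum_mul, ← Finset.sum_sub_distrib,
      Finset.sum_eq_single i]
    · rw [hy, perm_mul_xi_mul_eta, Equiv.swap_apply_left, sub_mul]
    · intro k hk hki
      rw [hy, perm_mul_xi_mul_eta, Equiv.swap_apply_of_ne_of_ne (Ne.symm hki) h.ne, sub_self]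
    · intro hi
      exact absurd (by simpa using h) hi
  have e1 : y i * y j = y j * y i + u • ((y i - y j) * s) := by rw [← hyy]; abel
  have e2 : y i * jucysMurphy t u j = jucysMurphy t u j * y i + (y i - y j) * s := by
    rw [← hyL]; abel
  rw [z_eq, z_eq]
  change (-y i + _) * (-y j + _) = (-y j + _) * (-y i + _)
  simp only [mul_add, add_mul, neg_mul, mul_neg, smul_mul_assoc, mul_smul_comm, e1, e2,
    hLj, hLL]
  module

theorem z_mul_z (i j : Fin n) : z t u i * z t u j = z t u j * z t u i := by
  rcases lt_trichotomy i j with h | rfl | h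
  · exact z_mul_z_of_lt t u h
  · rfl
  · exact (z_mul_z_of_lt t u h).symm

end OddDaHa

/-! ### Skew polynomials -/

/-- Anticommutation relations between distinct generators. -/
inductive SkewPolyRel (n : ℕ) : FreeAlgebra ℂ (Fin n) → FreeAlgebra ℂ (Fin n) → Prop
  | mul_swap (i j : Fin n) (h : i ≠ j) :
      SkewPolyRel n (FreeAlgebra.ι ℂ i * FreeAlgebra.ι ℂ j + FreeAlgebra.ι ℂ j * FreeAlgebra.ι ℂ i) 0

/-- The algebra generated by pairwise anticommuting `x_i`. -/
def SkewPoly (n : ℕ) : Type := RingQuot (SkewPolyRel n)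

namespace SkewPoly

variable {n : ℕ}

/-- The ring structure of skew polynomials; it is not reducible, so that instance unification does
not look into the quotient. -/
noncomputable def ringStructure (n : ℕ) : Ring (SkewPoly n) where
  toSemiring := RingQuot.instSemiring _
  __ := RingQuot.instRing (SkewPolyRel n)

noncomputable instance : Ring (SkewPoly n) := ringStructure n

/-- The algebra structure of skew polynomials. -/
noncomputable def algebraStructure (n : ℕ) : Algebra ℂ (SkewPoly n) :=
  RingQuot.instAlgebra (SkewPolyRel n)

noncomputable instance : Algebra ℂ (SkewPoly n) := algebraStructure n

/-- The quotient map from the free algebra. -/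
noncomputable def mk (n : ℕ) : FreeAlgebra ℂ (Fin n) →ₐ[ℂ] SkewPoly n :=
  RingQuot.mkAlgHom ℂ (SkewPolyRel n)

/-- The generator `x_i`. -/
noncomputable def X (i : Fin n) : SkewPoly n := mk n (FreeAlgebra.ι ℂ i)

theorem X_mul_X {i j : Fin n} (h : i ≠ j) : X i * X j + X j * X i = 0 := by
  have : mk n (FreeAlgebra.ι ℂ i * FreeAlgebra.ι ℂ j + FreeAlgebra.ι ℂ j * FreeAlgebra.ι ℂ i) =
      mk n 0 := RingQuot.mkAlgHom_rel ℂ (SkewPolyRel.mul_swap i j h)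
  simpa [X] using this

/-- The universal property of skew polynomials. -/
noncomputable def lift {B : Type*} [Semiring B] [Algebra ℂ B] (f : Fin n → B)
    (hf : ∀ i j, i ≠ j → f i * f j + f j * f i = 0) : SkewPoly n →ₐ[ℂ] B :=
  RingQuot.liftAlgHom ℂ ⟨FreeAlgebra.lift ℂ f, by
    rintro _ _ ⟨i, j, h⟩
    simpa using hf i j h⟩

@[simp]
theorem lift_X {B : Type*} [Semiring B] [Algebra ℂ B] (f : Fin n → B)
    (hf : ∀ i j, i ≠ j → f i * f j + f j * f i = 0) (i : Fin n) : lift f hf (X i) = f i := by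
  refine (RingQuot.liftAlgHom_mkAlgHom_apply ℂ (FreeAlgebra.lift ℂ f) _ (FreeAlgebra.ι ℂ i)).trans ?_
  simp

theorem algHom_ext {B : Type*} [Semiring B] [Algebra ℂ B] {f g : SkewPoly n →ₐ[ℂ] B}
    (h : ∀ i, f (X i) = g (X i)) : f = g := by
  apply RingQuot.ringQuot_ext'
  apply FreeAlgebra.hom_ext
  funext i
  exact h i

/-- A submodule containing `1` and stable under left multiplication by the generators is the whole
algebra. -/
theorem submodule_eq_top (N : Submodule ℂ (SkewPoly n)) (h1 : 1 ∈ N)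
    (hX : ∀ i, ∀ p ∈ N, X i * p ∈ N) : N = ⊤ := by
  have key : ∀ a : FreeAlgebra ℂ (Fin n), ∀ p ∈ N, mk n a * p ∈ N := by
    intro a
    induction a using FreeAlgebra.induction with
    | grade0 r =>
      intro p hp
      rw [AlgHom.commutes, ← Algebra.smul_def]
      exact N.smul_mem r hp
    | grade1 i => exact hX i
    | mul a b ha hb =>
      intro p hp
      rw [map_mul, mul_assoc]
      exact ha _ (hb _ hp)
    | add a b ha hb =>
      intro p hp
      rw [map_add, add_mul]
      exact N.add_mem (ha _ hp) (hb _ hp)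
  rw [eq_top_iff]
  rintro p -
  obtain ⟨a, rfl⟩ : ∃ a, mk n a = p := RingQuot.mkAlgHom_surjective ℂ (SkewPolyRel n) p
  simpa using key a 1 h1

/-- The parity automorphism `x_i ↦ -x_i`. -/
noncomputable def parity (n : ℕ) : SkewPoly n →ₐ[ℂ] SkewPoly n :=
  lift (fun i => -X i) fun i j h => by rw [neg_mul_neg, neg_mul_neg, X_mul_X h]

/-- The automorphism permuting the generators. -/
noncomputable def rename (σ : Equiv.Perm (Fin n)) : SkewPoly n →ₐ[ℂ] SkewPoly n :=
  lift (fun i => X (σ i)) fun _ _ h => X_mul_X (σ.injective.ne h)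

@[simp]
theorem parity_X (i : Fin n) : parity n (X i) = -X i := by simp [parity]

@[simp]
theorem rename_X (σ : Equiv.Perm (Fin n)) (i : Fin n) : rename σ (X i) = X (σ i) := by
  simp [rename]

theorem rename_one : rename (1 : Equiv.Perm (Fin n)) = AlgHom.id ℂ _ :=
  algHom_ext fun i => by simp

theorem rename_mul (σ τ : Equiv.Perm (Fin n)) : rename (σ * τ) = (rename σ).comp (rename τ) :=
  algHom_ext fun i => by simp

/-- `p ↦ !![parity p, D p; 0, σ p]` where `D` is the skew derivation twisted by `σ` with
`D x_i = δ i`. -/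
noncomputable def skewDerivMatrix (σ : Equiv.Perm (Fin n)) (δ : Fin n → ℂ)
    (h : ∀ i j, i ≠ j → δ i • X (σ j) + δ j • X (σ i) = δ j • X i + δ i • X j) :
    SkewPoly n →ₐ[ℂ] Matrix (Fin 2) (Fin 2) (SkewPoly n) :=
  lift (fun i => !![-X i, δ i • 1; 0, X (σ i)]) fun i j hij => by
    -- The hypothesis `h` is exactly the vanishing of the upper right entry of the anticommutator of
    -- the two matrices.
    have h' := h i j hij
    rw [← sub_eq_zero] at h'
    have h2 := X_mul_X hij
    have h3 := X_mul_X (σ.injective.ne hij)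
    rw [Matrix.mul_fin_two, Matrix.mul_fin_two, ← Matrix.ext_iff]
    intro a b
    fin_cases a <;> fin_cases b
    · simpa using h2
    · simp only [Fin.zero_eta, Fin.mk_one, Matrix.add_apply, Matrix.of_apply, Matrix.cons_val',
        Matrix.cons_val_zero, Matrix.cons_val_one, Matrix.cons_val_fin_one, Matrix.zero_apply,
        neg_mul, mul_smul_comm, smul_mul_assoc, mul_one, one_mul]
      rw [← h']
      simp only [smul_neg]
      abel
    · simp
    · simpa using h3

/-- The skew derivation twisted by `σ` with `D x_i = δ i`. -/
noncomputable def skewDeriv (σ : Equiv.Perm (Fin n)) (δ : Fin n → ℂ)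
    (h : ∀ i j, i ≠ j → δ i • X (σ j) + δ j • X (σ i) = δ j • X i + δ i • X j) :
    SkewPoly n →ₗ[ℂ] SkewPoly n where
  toFun p := skewDerivMatrix σ δ h p 0 1
  map_add' p q := by simp
  map_smul' r p := by simp

section skewDeriv

variable (σ : Equiv.Perm (Fin n)) (δ : Fin n → ℂ)
  (h : ∀ i j, i ≠ j → δ i • X (σ j) + δ j • X (σ i) = δ j • X i + δ i • X j)

theorem skewDerivMatrix_apply_one_one (p : SkewPoly n) :
    skewDerivMatrix σ δ h p 1 1 = rename σ p := by
  suffices H : LinearMap.eqLocus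
      ((Matrix.entryLinearMap ℂ (SkewPoly n) (1 : Fin 2) (1 : Fin 2)).comp
        (skewDerivMatrix σ δ h).toLinearMap) (rename σ).toLinearMap = ⊤ by
    have : p ∈ (⊤ : Submodule ℂ (SkewPoly n)) := trivial
    rw [← H] at this
    simpa using this
  apply submodule_eq_top
  · simp
  · intro i p hp
    simp only [LinearMap.mem_eqLocus, LinearMap.comp_apply, AlgHom.toLinearMap_apply,
      Matrix.entryLinearMap_apply] at hp ⊢
    rw [map_mul, map_mul, Matrix.mul_apply, Fin.sum_univ_two, hp]
    simp [skewDerivMatrix]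

@[simp]
theorem skewDeriv_one : skewDeriv σ δ h 1 = 0 := by simp [skewDeriv]

/-- The twisted Leibniz rule is the upper right entry of a product of triangular matrices. -/
theorem skewDeriv_X_mul (i : Fin n) (p : SkewPoly n) :
    skewDeriv σ δ h (X i * p) = δ i • rename σ p - X i * skewDeriv σ δ h p := by
  change skewDerivMatrix σ δ h (X i * p) 0 1 = _ - X i * skewDerivMatrix σ δ h p 0 1
  rw [map_mul, Matrix.mul_apply, Fin.sum_univ_two, skewDerivMatrix_apply_one_one]
  simp only [skewDerivMatrix, lift_X, Matrix.of_apply, Matrix.cons_val', Matrix.cons_val_zero,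
    Matrix.cons_val_one, Matrix.cons_val_fin_one, neg_mul, smul_mul_assoc, one_mul]
  abel

end skewDeriv

/-- The skew partial derivative `∂_i`. -/
noncomputable def pderiv (i : Fin n) : SkewPoly n →ₗ[ℂ] SkewPoly n :=
  skewDeriv 1 (fun j => if j = i then 1 else 0) fun _ _ _ => by
    simp only [Equiv.Perm.one_apply]
    abel

/-- The twisted skew derivation attached to the transposition `s_{ik}`, with value `1` on
`x_i` and `x_k` and `0` on the other generators. -/
noncomputable def swapDeriv (i k : Fin n) : SkewPoly n →ₗ[ℂ] SkewPoly n :=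
  -- The twist by s_ik forces equal values on x_i and x_k; these match the term u s_ik in the
  -- anticommutators of η_i with both ξ_i and ξ_k.
  skewDeriv (Equiv.swap i k) (fun j => if j = i ∨ j = k then 1 else 0) fun a b hab => by
    simp only [Equiv.swap_apply_def]
    split_ifs <;> simp_all [add_comm]

theorem pderiv_one (i : Fin n) : pderiv i 1 = 0 := skewDeriv_one _ _ _

theorem swapDeriv_one (i k : Fin n) : swapDeriv i k 1 = 0 := skewDeriv_one _ _ _

theorem pderiv_X_mul (i j : Fin n) (p : SkewPoly n) :
    pderiv i (X j * p) = (if j = i then (1 : ℂ) else 0) • p - X j * pderiv i p := by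
  rw [pderiv, skewDeriv_X_mul, rename_one]
  rfl

theorem swapDeriv_X_mul (i k j : Fin n) (p : SkewPoly n) :
    swapDeriv i k (X j * p) =
      (if j = i ∨ j = k then (1 : ℂ) else 0) • rename (Equiv.swap i k) p -
        X j * swapDeriv i k p :=
  skewDeriv_X_mul _ _ _ _ _

end SkewPoly

open TensorProduct

/-! ### A representation of the odd double affine Hecke algebra -/

namespace OddDaHa

attribute [local instance] ring

section Clifford

variable (n : ℕ)

/-- The complex Clifford algebra with generators `c_i` satisfying `c_i ^ 2 = 1`. -/
abbrev Cliff : Type :=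
  CliffordAlgebra (QuadraticMap.weightedSumSquares ℂ (fun _ : Fin n => (1 : ℂ)))

variable {n}

/-- The Clifford generator `c_i`. -/
noncomputable def cliff (i : Fin n) : Cliff n := CliffordAlgebra.ι _ (Pi.single i 1)

theorem cliff_mul_self (i : Fin n) : cliff i * cliff i = 1 := by
  rw [cliff, CliffordAlgebra.ι_sq_scalar]
  simp [QuadraticMap.weightedSumSquares_apply, Pi.single_apply]

theorem cliff_mul_cliff {i j : Fin n} (h : i ≠ j) :
    cliff i * cliff j + cliff j * cliff i = 0 := by
  apply CliffordAlgebra.ι_mul_ι_add_swap_of_isOrtho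
  rw [QuadraticMap.isOrtho_def]
  simp only [QuadraticMap.weightedSumSquares_apply, Pi.add_apply, one_smul]
  rw [← Finset.sum_add_distrib]
  refine Finset.sum_congr rfl fun k _ => ?_
  rcases eq_or_ne k i with rfl | hk
  · simp [h]
  · simp [hk]

theorem isUnit_cliff (i : Fin n) : IsUnit (cliff i) :=
  ⟨⟨cliff i, cliff i, cliff_mul_self i, cliff_mul_self i⟩, rfl⟩

/-- The left regular action of `σ` on functions on the symmetric group. -/
noncomputable def fnPerm (σ : Equiv.Perm (Fin n)) :
    (Equiv.Perm (Fin n) → Cliff n) →ₗ[ℂ] (Equiv.Perm (Fin n) → Cliff n) :=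
  LinearMap.funLeft ℂ (Cliff n) fun g => σ⁻¹ * g

/-- The action of the Clifford generators twisted by the symmetric group. -/
noncomputable def fnCliff (i : Fin n) :
    (Equiv.Perm (Fin n) → Cliff n) →ₗ[ℂ] (Equiv.Perm (Fin n) → Cliff n) where
  toFun f g := cliff (g⁻¹ i) * f g
  map_add' _ _ := by ext; simp [mul_add]
  map_smul' _ _ := by ext; simp

theorem fnPerm_apply (σ g : Equiv.Perm (Fin n)) (f) : fnPerm σ f g = f (σ⁻¹ * g) := rfl

theorem fnCliff_apply (i : Fin n) (f) (g : Equiv.Perm (Fin n)) :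
    fnCliff i f g = cliff (g⁻¹ i) * f g := rfl

theorem fnPerm_one : fnPerm (1 : Equiv.Perm (Fin n)) = LinearMap.id := by
  ext f g
  simp [fnPerm_apply]

theorem fnPerm_mul (σ τ : Equiv.Perm (Fin n)) : fnPerm (σ * τ) = fnPerm σ * fnPerm τ := by
  refine LinearMap.ext fun f => funext fun g => ?_
  simp [fnPerm_apply, mul_assoc]

/-- The twist by g⁻¹ in `fnCliff` serves to make this equivariance hold. -/
theorem fnPerm_fnCliff (σ : Equiv.Perm (Fin n)) (i : Fin n) (f) :
    fnPerm σ (fnCliff i f) = fnCliff (σ i) (fnPerm σ f) := by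
  funext g
  simp [fnPerm_apply, fnCliff_apply]

theorem fnCliff_fnCliff {i j : Fin n} (h : i ≠ j) (f) :
    fnCliff i (fnCliff j f) + fnCliff j (fnCliff i f) = 0 := by
  funext g
  simp only [fnCliff_apply, Pi.add_apply, Pi.zero_apply]
  rw [← mul_assoc, ← mul_assoc, ← add_mul, cliff_mul_cliff (g⁻¹.injective.ne h), zero_mul]

end Clifford

/-! ### The Fock space and the operators of the generators. -/

variable {n : ℕ} (t u : ℂ)

/-- The underlying space of the representation. -/
def Fock (n : ℕ) : Type := SkewPoly n ⊗[ℂ] (Equiv.Perm (Fin n) → Cliff n)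

namespace Fock

/-- The additive group structure of the Fock space. -/
noncomputable def addCommGroupStructure (n : ℕ) : AddCommGroup (Fock n) :=
  TensorProduct.addCommGroup

noncomputable instance : AddCommGroup (Fock n) := addCommGroupStructure n

/-- The vector space structure of the Fock space. -/
noncomputable def moduleStructure (n : ℕ) : Module ℂ (Fock n) :=
  TensorProduct.leftModule

noncomputable instance : Module ℂ (Fock n) := moduleStructure n

/-- The pure tensors. -/
noncomputable def tmul : SkewPoly n →ₗ[ℂ] (Equiv.Perm (Fin n) → Cliff n) →ₗ[ℂ] Fock n :=
  TensorProduct.mk ℂ _ _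

/-- The linear map determined by a bilinear map. -/
noncomputable def lift {N : Type*} [AddCommMonoid N] [Module ℂ N]
    (f : SkewPoly n →ₗ[ℂ] (Equiv.Perm (Fin n) → Cliff n) →ₗ[ℂ] N) : Fock n →ₗ[ℂ] N :=
  TensorProduct.lift f

theorem lift_tmul {N : Type*} [AddCommMonoid N] [Module ℂ N]
    (f : SkewPoly n →ₗ[ℂ] (Equiv.Perm (Fin n) → Cliff n) →ₗ[ℂ] N) (p v) :
    lift f (tmul p v) = f p v :=
  TensorProduct.lift.tmul _ _

/-- The tensor product of two operators. -/
noncomputable def map (f : Module.End ℂ (SkewPoly n))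
    (g : Module.End ℂ (Equiv.Perm (Fin n) → Cliff n)) : Module.End ℂ (Fock n) :=
  lift (tmul.compl₁₂ f g)

theorem map_tmul (f : Module.End ℂ (SkewPoly n)) (g : Module.End ℂ (Equiv.Perm (Fin n) → Cliff n))
    (p v) : map f g (tmul p v) = tmul (f p) (g v) := by
  rw [map, lift_tmul]
  rfl

theorem hom_ext {N : Type*} [AddCommMonoid N] [Module ℂ N] {f g : Fock n →ₗ[ℂ] N}
    (h : ∀ p v, f (tmul p v) = g (tmul p v)) : f = g :=
  TensorProduct.ext' h

end Fock

/-- The operator by which `ξ_i` acts. -/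
noncomputable def xiOp (i : Fin n) : Module.End ℂ (Fock n) :=
  Fock.map (LinearMap.mulLeft ℂ (SkewPoly.X i)) LinearMap.id

/-- The operator by which `σ` acts. -/
noncomputable def permOp (σ : Equiv.Perm (Fin n)) : Module.End ℂ (Fock n) :=
  Fock.map (SkewPoly.rename σ).toLinearMap (fnPerm σ)

/-- The part of the operator of `η_i` which lowers the degree of skew polynomials. -/
noncomputable def etaLower (i : Fin n) : Module.End ℂ (Fock n) :=
  t • Fock.map (SkewPoly.pderiv i) LinearMap.id +
    u • ∑ k ∈ Finset.univ.filter (fun k => k ≠ i),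
      Fock.map (SkewPoly.swapDeriv i k) (fnPerm (Equiv.swap i k))

/-- The operator by which `η_i` acts. -/
noncomputable def etaOp (i : Fin n) : Module.End ℂ (Fock n) :=
  etaLower t u i + Fock.map (SkewPoly.parity n).toLinearMap (fnCliff i)

/-- The value of the anticommutator of `η_i` and `ξ_j`. -/
noncomputable def anticomm (i j : Fin n) : Module.End ℂ (Fock n) :=
  if i = j then t • 1 + u • ∑ k ∈ Finset.univ.filter (fun k => k ≠ i), permOp (Equiv.swap k i)
  else u • permOp (Equiv.swap i j)

theorem xiOp_tmul (i : Fin n) (p : SkewPoly n) (v) :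
    xiOp i (Fock.tmul p v) = Fock.tmul (SkewPoly.X i * p) v := Fock.map_tmul _ _ _ _

theorem permOp_tmul (σ : Equiv.Perm (Fin n)) (p : SkewPoly n) (v) :
    permOp σ (Fock.tmul p v) = Fock.tmul (SkewPoly.rename σ p) (fnPerm σ v) :=
  Fock.map_tmul _ _ _ _

theorem etaLower_tmul (i : Fin n) (p : SkewPoly n) (v) :
    etaLower t u i (Fock.tmul p v) = t • Fock.tmul (SkewPoly.pderiv i p) v +
      u • ∑ k ∈ Finset.univ.filter (fun k => k ≠ i),
        Fock.tmul (SkewPoly.swapDeriv i k p) (fnPerm (Equiv.swap i k) v) := by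
  simp [etaLower, Fock.map_tmul]

theorem etaOp_tmul (i : Fin n) (p : SkewPoly n) (v) :
    etaOp t u i (Fock.tmul p v) =
      etaLower t u i (Fock.tmul p v) + Fock.tmul (SkewPoly.parity n p) (fnCliff i v) := by
  simp [etaOp, Fock.map_tmul]

theorem permOp_one : permOp (1 : Equiv.Perm (Fin n)) = 1 := by
  refine Fock.hom_ext fun p v => ?_
  simp [permOp_tmul, SkewPoly.rename_one, fnPerm_one]

theorem permOp_mul (σ τ : Equiv.Perm (Fin n)) : permOp (σ * τ) = permOp σ * permOp τ := by
  refine Fock.hom_ext fun p v => ?_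
  simp [permOp_tmul, SkewPoly.rename_mul, fnPerm_mul]

theorem permOp_mul_permOp_swap (σ : Equiv.Perm (Fin n)) (i j : Fin n) :
    permOp σ * permOp (Equiv.swap i j) = permOp (Equiv.swap (σ i) (σ j)) * permOp σ := by
  rw [← permOp_mul, ← permOp_mul, Equiv.swap_apply_apply]
  simp

theorem permOp_mul_xiOp (σ : Equiv.Perm (Fin n)) (i : Fin n) :
    permOp σ * xiOp i = xiOp (σ i) * permOp σ := by
  refine Fock.hom_ext fun p v => ?_
  simp [permOp_tmul, xiOp_tmul]

theorem xiOp_mul_xiOp {i j : Fin n} (h : i ≠ j) : xiOp i * xiOp j = -(xiOp j * xiOp i) := by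
  refine Fock.hom_ext fun p v => ?_
  rw [eq_comm, LinearMap.neg_apply, neg_eq_iff_add_eq_zero]
  simp only [Module.End.mul_apply, xiOp_tmul]
  rw [← LinearMap.add_apply, ← map_add, ← mul_assoc, ← mul_assoc, ← add_mul,
    SkewPoly.X_mul_X h.symm, zero_mul, map_zero, LinearMap.zero_apply]

theorem permOp_mul_anticomm (σ : Equiv.Perm (Fin n)) (i j : Fin n) :
    permOp σ * anticomm t u i j = anticomm t u (σ i) (σ j) * permOp σ := by
  by_cases h : i = j
  · subst h
    simp only [anticomm, if_true, mul_add, add_mul, mul_smul_comm, smul_mul_assoc, mul_one, one_mul,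
      Finset.mul_sum, Finset.sum_mul]
    congr 2
    refine Finset.sum_bij (fun k _ => σ k) ?_ ?_ ?_ ?_
    · intro k hk
      simpa using hk
    · intro a _ b _ hab
      exact σ.injective hab
    · intro b hb
      exact ⟨σ.symm b, by simpa [Equiv.symm_apply_eq] using hb, by simp⟩
    · intro k _
      exact permOp_mul_permOp_swap σ k i
  · rw [anticomm, anticomm, if_neg h, if_neg (σ.injective.ne h), mul_smul_comm,
      permOp_mul_permOp_swap, smul_mul_assoc]

/-- The Leibniz rules of the Dunkl part produce the anticommutator; the Clifford part contributes
nothing, since parity makes it anticommute with every ξ_j. -/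
theorem etaOp_mul_xiOp (i j : Fin n) :
    etaOp t u i * xiOp j = anticomm t u i j - xiOp j * etaOp t u i := by
  refine Fock.hom_ext fun p v => ?_
  have hC : anticomm t u i j (Fock.tmul p v) = t • Fock.tmul ((if j = i then (1 : ℂ) else 0) • p) v +
      u • ∑ k ∈ Finset.univ.filter (fun k => k ≠ i),
        Fock.tmul ((if j = i ∨ j = k then (1 : ℂ) else 0) • SkewPoly.rename (Equiv.swap i k) p)
          (fnPerm (Equiv.swap i k) v) := by
    rw [anticomm]
    by_cases h : i = j
    · subst h
      simp [permOp_tmul, Equiv.swap_comm]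
    · rw [if_neg h, if_neg (Ne.symm h), Finset.sum_eq_single j]
      · simp [permOp_tmul]
      · intro k _ hk
        rw [if_neg (by simp [Ne.symm h, Ne.symm hk]), zero_smul, map_zero, LinearMap.zero_apply]
      · intro hj
        simp [Ne.symm h] at hj
  rw [LinearMap.sub_apply, hC]
  simp only [Module.End.mul_apply, xiOp_tmul, etaOp_tmul, etaLower_tmul, SkewPoly.pderiv_X_mul,
    SkewPoly.swapDeriv_X_mul, map_mul, SkewPoly.parity_X, map_sub, LinearMap.sub_apply, map_add, LinearMap.smul_apply, map_smul,
    map_sum, Finset.sum_sub_distrib, neg_mul, map_neg, LinearMap.neg_apply]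
  module

theorem etaOp_one_tmul (i : Fin n) (v) :
    etaOp t u i (Fock.tmul 1 v) = Fock.tmul (1 : SkewPoly n) (fnCliff i v) := by
  simp [etaOp_tmul, etaLower_tmul, SkewPoly.pderiv_one, SkewPoly.swapDeriv_one]

theorem permOp_one_tmul (σ : Equiv.Perm (Fin n)) (v) :
    permOp σ (Fock.tmul 1 v) = Fock.tmul (1 : SkewPoly n) (fnPerm σ v) := by
  simp [permOp_tmul]

/-- An operator which quasi-commutes with all `ξ_i` and kills the vacuum vectors vanishes. -/
theorem end_eq_zero (D : Module.End ℂ (Fock n)) (hX : ∀ i, ∃ A, D * xiOp i = A * D)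
    (h1 : ∀ v, D (Fock.tmul 1 v) = 0) : D = 0 := by
  refine Fock.hom_ext fun p v => ?_
  -- For fixed `v`, the polynomials p with D (p ⊗ v) = 0 contain 1 and are stable under the X_i.
  have : LinearMap.ker (D.comp (Fock.tmul.flip v)) = ⊤ := by
    apply SkewPoly.submodule_eq_top
    · simpa using h1 v
    · intro i p hp
      obtain ⟨A, hA⟩ := hX i
      have hp : D (Fock.tmul p v) = 0 := by simpa using hp
      have := LinearMap.congr_fun hA (Fock.tmul p v)
      simpa [hp, xiOp_tmul] using this
  have hp : p ∈ LinearMap.ker (D.comp (Fock.tmul.flip v)) := by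
    rw [this]; trivial
  simpa using hp

/-- The difference of the two sides quasi-commutes with the ξ_k and kills the vacuum vectors, so
`end_eq_zero` replaces a computation with Dunkl operators. -/
theorem permOp_mul_etaOp (σ : Equiv.Perm (Fin n)) (i : Fin n) :
    permOp σ * etaOp t u i = etaOp t u (σ i) * permOp σ := by
  rw [← sub_eq_zero]
  apply end_eq_zero
  · intro k
    refine ⟨-xiOp (σ k), ?_⟩
    have e1 : permOp σ * etaOp t u i * xiOp k =
        permOp σ * anticomm t u i k - xiOp (σ k) * (permOp σ * etaOp t u i) := by
      rw [mul_assoc, etaOp_mul_xiOp, mul_sub, ← mul_assoc, permOp_mul_xiOp, mul_assoc]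
    have e2 : etaOp t u (σ i) * permOp σ * xiOp k =
        anticomm t u (σ i) (σ k) * permOp σ - xiOp (σ k) * (etaOp t u (σ i) * permOp σ) := by
      rw [mul_assoc, permOp_mul_xiOp, ← mul_assoc, etaOp_mul_xiOp, sub_mul, mul_assoc]
    rw [sub_mul, e1, e2, permOp_mul_anticomm, neg_mul, mul_sub]
    abel
  · intro v
    simp only [LinearMap.sub_apply, Module.End.mul_apply, etaOp_one_tmul, permOp_one_tmul,
      fnPerm_fnCliff, sub_self]

/-- Among the transpositions in `anticomm t u i i` only s_ij fails to commute with η_j, and [η_j,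
s_ij] = -[η_i, s_ij]. -/
theorem etaOp_commutator_anticomm {i j : Fin n} (h : i ≠ j) :
    etaOp t u i * anticomm t u j i - anticomm t u j i * etaOp t u i +
      (etaOp t u j * anticomm t u i i - anticomm t u i i * etaOp t u j) = 0 := by
  have hs : ∀ k, k ≠ i → k ≠ j →
      permOp (Equiv.swap k i) * etaOp t u j = etaOp t u j * permOp (Equiv.swap k i) := by
    intro k _ hkj
    rw [permOp_mul_etaOp, Equiv.swap_apply_of_ne_of_ne hkj.symm h.symm]
  have hC : etaOp t u j * anticomm t u i i - anticomm t u i i * etaOp t u j =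
      u • (etaOp t u j * permOp (Equiv.swap j i) - permOp (Equiv.swap j i) * etaOp t u j) := by
    simp only [anticomm, if_true, mul_add, add_mul, mul_smul_comm, smul_mul_assoc, mul_one, one_mul,
      Finset.mul_sum, Finset.sum_mul]
    rw [add_sub_add_left_eq_sub, ← smul_sub, ← Finset.sum_sub_distrib, Finset.sum_eq_single j]
    · intro k hk hkj
      rw [hs k (by simpa using hk) hkj, sub_self]
    · intro hj
      simp [h.symm] at hj
  rw [hC, anticomm, if_neg h.symm, permOp_mul_etaOp, Equiv.swap_apply_left, mul_smul_comm,
    smul_mul_assoc, permOp_mul_etaOp, Equiv.swap_apply_right, smul_sub]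
  abel

/-- The anticommutator of η_i and η_j commutes with every ξ_k and vanishes on vacuum vectors because
c_i and c_j anticommute there; `end_eq_zero` concludes. -/
theorem etaOp_mul_etaOp {i j : Fin n} (h : i ≠ j) :
    etaOp t u i * etaOp t u j = -(etaOp t u j * etaOp t u i) := by
  rw [eq_neg_iff_add_eq_zero]
  apply end_eq_zero
  · intro k
    refine ⟨xiOp k, ?_⟩
    have e : ∀ a b : Fin n, etaOp t u a * etaOp t u b * xiOp k =
        etaOp t u a * anticomm t u b k - anticomm t u a k * etaOp t u b +
          xiOp k * (etaOp t u a * etaOp t u b) := by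
      intro a b
      rw [mul_assoc, etaOp_mul_xiOp, mul_sub, ← mul_assoc _ (xiOp k), etaOp_mul_xiOp, sub_mul,
        mul_assoc]
      abel
    have key : etaOp t u i * anticomm t u j k - anticomm t u j k * etaOp t u i +
      (etaOp t u j * anticomm t u i k - anticomm t u i k * etaOp t u j) = 0 := by
      rcases eq_or_ne k i with rfl | hki
      · exact etaOp_commutator_anticomm t u h
      rcases eq_or_ne k j with rfl | hkj
      · rw [add_comm]
        exact etaOp_commutator_anticomm t u h.symm
      · rw [anticomm, anticomm, if_neg hkj.symm, if_neg hki.symm, smul_mul_assoc, smul_mul_assoc,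
          permOp_mul_etaOp, permOp_mul_etaOp, Equiv.swap_apply_of_ne_of_ne h hki.symm,
          Equiv.swap_apply_of_ne_of_ne h.symm hkj.symm, mul_smul_comm, mul_smul_comm, sub_self,
          sub_self, add_zero]
    rw [add_mul, e, e, mul_add, ← sub_eq_zero, ← key]
    abel
  · intro v
    simp only [LinearMap.add_apply, Module.End.mul_apply, etaOp_one_tmul]
    rw [← map_add, fnCliff_fnCliff h, map_zero]

open OddDaHaGen in
/-- The representation of the odd double affine Hecke algebra on `Fock n`. -/
noncomputable def fockRep : OddDaHa n t u →ₐ[ℂ] Module.End ℂ (Fock n) :=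
  RingQuot.liftAlgHom ℂ ⟨FreeAlgebra.lift ℂ fun
    | .xi i => xiOp i
    | .eta i => etaOp t u i
    | .perm σ => permOp σ, by
    intro a b hab
    cases hab with
    | perm_one => simpa using permOp_one
    | perm_mul σ τ => simpa using permOp_mul σ τ
    | eta_eta i j h => simpa using etaOp_mul_etaOp t u h
    | xi_xi i j h => simpa using xiOp_mul_xiOp h
    | perm_xi σ j => simpa using permOp_mul_xiOp σ j
    | perm_eta σ j => simpa using permOp_mul_etaOp t u σ j
    | eta_xi_ne i j h => simp [etaOp_mul_xiOp, anticomm, h]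
    | eta_xi_self i => simp [etaOp_mul_xiOp, anticomm]⟩

theorem fockRep_xi (i : Fin n) : fockRep t u (xi t u i) = xiOp i := by simp [fockRep, xi]

theorem fockRep_eta (i : Fin n) : fockRep t u (eta t u i) = etaOp t u i := by simp [fockRep, eta]

theorem fockRep_perm (σ : Equiv.Perm (Fin n)) : fockRep t u (perm t u σ) = permOp σ := by
  simp [fockRep, perm]

end OddDaHa


/-! ### Degree filtration and leading terms -/

namespace SkewPoly

variable {n : ℕ}

/-- The product of the generators along a list. -/
noncomputable def listProd (l : List (Fin n)) : SkewPoly n := (l.map X).prod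

@[simp]
theorem listProd_nil : listProd ([] : List (Fin n)) = 1 := rfl

@[simp]
theorem listProd_cons (i : Fin n) (l : List (Fin n)) : listProd (i :: l) = X i * listProd l := by
  simp [listProd]

/-- The skew polynomials of degree less than `d`. -/
noncomputable def degreeLT (n d : ℕ) : Submodule ℂ (SkewPoly n) :=
  Submodule.span ℂ (listProd '' {l | l.length < d})

theorem listProd_mem_degreeLT {l : List (Fin n)} {d : ℕ} (h : l.length < d) :
    listProd l ∈ degreeLT n d :=
  Submodule.subset_span ⟨l, h, rfl⟩

theorem degreeLT_mono {d e : ℕ} (h : d ≤ e) : degreeLT n d ≤ degreeLT n e :=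
  Submodule.span_mono (Set.image_mono fun _ hl => lt_of_lt_of_le hl h)

theorem map_mem_of_mem_degreeLT {N : Type*} [AddCommMonoid N] [Module ℂ N]
    (f : SkewPoly n →ₗ[ℂ] N) (P : Submodule ℂ N) {d : ℕ}
    (h : ∀ l : List (Fin n), l.length < d → f (listProd l) ∈ P) {p : SkewPoly n}
    (hp : p ∈ degreeLT n d) : f p ∈ P := by
  have : degreeLT n d ≤ P.comap f := by
    rw [degreeLT, Submodule.span_le]
    rintro _ ⟨l, hl, rfl⟩
    exact h l hl
  exact this hp

theorem X_mul_mem_degreeLT (i : Fin n) {d : ℕ} {p : SkewPoly n} (hp : p ∈ degreeLT n d) :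
    X i * p ∈ degreeLT n (d + 1) := by
  refine map_mem_of_mem_degreeLT (LinearMap.mulLeft ℂ (X i)) _ (fun l hl => ?_) hp
  rw [LinearMap.mulLeft_apply, ← listProd_cons]
  exact listProd_mem_degreeLT (by simpa using hl)

theorem rename_listProd (σ : Equiv.Perm (Fin n)) (l : List (Fin n)) :
    rename σ (listProd l) = listProd (l.map σ) := by
  induction l with
  | nil => simp
  | cons i l ih => simp [ih]

theorem rename_mem_degreeLT (σ : Equiv.Perm (Fin n)) {d : ℕ} {p : SkewPoly n}
    (hp : p ∈ degreeLT n d) : rename σ p ∈ degreeLT n d := by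
  refine map_mem_of_mem_degreeLT (rename σ).toLinearMap _ (fun l hl => ?_) hp
  rw [AlgHom.toLinearMap_apply, rename_listProd]
  exact listProd_mem_degreeLT (by simpa using hl)

theorem parity_listProd (l : List (Fin n)) :
    parity n (listProd l) = (-1 : ℂ) ^ l.length • listProd l := by
  induction l with
  | nil => simp
  | cons i l ih => simp [ih, pow_succ]

theorem parity_mem_degreeLT {d : ℕ} {p : SkewPoly n} (hp : p ∈ degreeLT n d) :
    parity n p ∈ degreeLT n d := by
  refine map_mem_of_mem_degreeLT (parity n).toLinearMap _ (fun l hl => ?_) hp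
  rw [AlgHom.toLinearMap_apply, parity_listProd]
  exact Submodule.smul_mem _ _ (listProd_mem_degreeLT hl)

theorem skewDeriv_mem_degreeLT (σ : Equiv.Perm (Fin n)) (δ : Fin n → ℂ)
    (h : ∀ i j, i ≠ j → δ i • X (σ j) + δ j • X (σ i) = δ j • X i + δ i • X j) {d : ℕ}
    {p : SkewPoly n} (hp : p ∈ degreeLT n (d + 1)) : skewDeriv σ δ h p ∈ degreeLT n d := by
  refine map_mem_of_mem_degreeLT _ _ (fun l hl => degreeLT_mono (Nat.lt_succ_iff.1 hl) ?_) hp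
  clear hl
  induction l with
  | nil => simp
  | cons i l ih =>
    rw [listProd_cons, skewDeriv_X_mul, rename_listProd]
    exact Submodule.sub_mem _ (Submodule.smul_mem _ _ (listProd_mem_degreeLT (by simp)))
      (X_mul_mem_degreeLT i ih)

end SkewPoly

/-! ### Leading terms in the Fock space and linear independence. -/

namespace OddDaHa

open SkewPoly

attribute [local instance] ring

variable {n : ℕ} (t u : ℂ)

/-- The homomorphism `x_i ↦ c_i e^i` to the Clifford-valued polynomials. -/
noncomputable def cliffordPoly (n : ℕ) :
    SkewPoly n →ₐ[ℂ] AddMonoidAlgebra (Cliff n) (Multiset (Fin n)) :=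
  SkewPoly.lift (fun i => AddMonoidAlgebra.single {i} (cliff i)) fun i j h => by
    rw [AddMonoidAlgebra.single_mul_single, AddMonoidAlgebra.single_mul_single, add_comm ({j} : Multiset (Fin n)) {i},
      ← AddMonoidAlgebra.single_add, cliff_mul_cliff h, AddMonoidAlgebra.single_zero]

theorem cliffordPoly_listProd (l : List (Fin n)) :
    cliffordPoly n (listProd l) =
      AddMonoidAlgebra.single (l : Multiset (Fin n)) (l.map cliff).prod := by
  induction l with
  | nil => simp [AddMonoidAlgebra.one_def]
  | cons i l ih =>
    rw [listProd_cons, map_mul, ih, cliffordPoly, lift_X, AddMonoidAlgebra.single_mul_single,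
      Multiset.singleton_add, Multiset.cons_coe, List.map_cons, List.prod_cons]

/-- The Clifford-valued coefficient of a monomial in a skew polynomial. -/
noncomputable def cliffordCoeff (a : Multiset (Fin n)) : SkewPoly n →ₗ[ℂ] Cliff n where
  toFun p := (cliffordPoly n p).coeff a
  map_add' p q := by simp
  map_smul' r p := by simp

/-- Monomials with different multisets of variables are separated, and each has a product of
Clifford generators, hence a unit, as coefficient. This takes the place of a basis of `SkewPoly n`.
-/
theorem cliffordCoeff_listProd (a : Multiset (Fin n)) (l : List (Fin n)) :
    cliffordCoeff a (listProd l) =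
      if (l : Multiset (Fin n)) = a then (l.map cliff).prod else 0 := by
  change (cliffordPoly n (listProd l)).coeff a = _
  rw [cliffordPoly_listProd, AddMonoidAlgebra.coeff_single, Finsupp.single_apply]

theorem cliffordCoeff_eq_zero {a : Multiset (Fin n)} {d : ℕ} (hd : d ≤ a.card) {p : SkewPoly n}
    (hp : p ∈ degreeLT n d) : cliffordCoeff a p = 0 := by
  rw [← Submodule.mem_bot ℂ]
  refine map_mem_of_mem_degreeLT _ _ (fun l hl => ?_) hp
  rw [Submodule.mem_bot, cliffordCoeff_listProd, if_neg]
  rintro rfl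
  simp at hd
  omega

namespace Fock

/-- The vectors of degree less than `d` in the skew polynomial variables. -/
noncomputable def degreeLT (n d : ℕ) : Submodule ℂ (Fock n) :=
  Submodule.span ℂ {x | ∃ p ∈ SkewPoly.degreeLT n d, ∃ v, tmul p v = x}

theorem tmul_mem_degreeLT {d : ℕ} {p : SkewPoly n} (hp : p ∈ SkewPoly.degreeLT n d) (v) :
    tmul p v ∈ degreeLT n d :=
  Submodule.subset_span ⟨p, hp, v, rfl⟩

theorem map_mem_of_mem_degreeLT {N : Type*} [AddCommMonoid N] [Module ℂ N]
    (f : Fock n →ₗ[ℂ] N) (P : Submodule ℂ N) {d : ℕ}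
    (h : ∀ p ∈ SkewPoly.degreeLT n d, ∀ v, f (tmul p v) ∈ P) {x : Fock n}
    (hx : x ∈ degreeLT n d) : f x ∈ P := by
  have : degreeLT n d ≤ P.comap f := by
    rw [degreeLT, Submodule.span_le]
    rintro _ ⟨p, hp, v, rfl⟩
    exact h p hp v
  exact this hx

theorem degreeLT_mono {d e : ℕ} (h : d ≤ e) : degreeLT n d ≤ degreeLT n e :=
  Submodule.span_mono fun _ ⟨p, hp, v, hx⟩ => ⟨p, SkewPoly.degreeLT_mono h hp, v, hx⟩

/-- The Clifford-valued coefficient of the monomial `a` in the component at `g`. -/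
noncomputable def coeff (a : Multiset (Fin n)) (g : Equiv.Perm (Fin n)) : Fock n →ₗ[ℂ] Cliff n :=
  lift ((LinearMap.mul ℂ (Cliff n)).compl₁₂ (cliffordCoeff a) (LinearMap.proj g))

theorem coeff_tmul (a : Multiset (Fin n)) (g : Equiv.Perm (Fin n)) (p v) :
    coeff a g (tmul p v) = cliffordCoeff a p * v g := by
  rw [coeff, lift_tmul]
  rfl

theorem coeff_eq_zero {a : Multiset (Fin n)} (g : Equiv.Perm (Fin n)) {d : ℕ} (hd : d ≤ a.card)
    {x : Fock n} (hx : x ∈ degreeLT n d) : coeff a g x = 0 := by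
  rw [← Submodule.mem_bot ℂ]
  refine map_mem_of_mem_degreeLT _ _ (fun p hp v => ?_) hx
  rw [Submodule.mem_bot, coeff_tmul, cliffordCoeff_eq_zero hd hp, zero_mul]

end Fock

theorem xiOp_mem_degreeLT (i : Fin n) {d : ℕ} {x : Fock n} (hx : x ∈ Fock.degreeLT n d) :
    xiOp i x ∈ Fock.degreeLT n (d + 1) := by
  refine Fock.map_mem_of_mem_degreeLT _ _ (fun p hp v => ?_) hx
  rw [xiOp_tmul]
  exact Fock.tmul_mem_degreeLT (X_mul_mem_degreeLT i hp) v

theorem permOp_mem_degreeLT (σ : Equiv.Perm (Fin n)) {d : ℕ} {x : Fock n}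
    (hx : x ∈ Fock.degreeLT n d) : permOp σ x ∈ Fock.degreeLT n d := by
  refine Fock.map_mem_of_mem_degreeLT _ _ (fun p hp v => ?_) hx
  rw [permOp_tmul]
  exact Fock.tmul_mem_degreeLT (rename_mem_degreeLT σ hp) _

theorem etaLower_mem_degreeLT (i : Fin n) {d : ℕ} {x : Fock n}
    (hx : x ∈ Fock.degreeLT n (d + 1)) : etaLower t u i x ∈ Fock.degreeLT n d := by
  refine Fock.map_mem_of_mem_degreeLT _ _ (fun p hp v => ?_) hx
  rw [etaLower_tmul]
  exact Submodule.add_mem _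
    (Submodule.smul_mem _ _ (Fock.tmul_mem_degreeLT (skewDeriv_mem_degreeLT _ _ _ hp) _))
    (Submodule.smul_mem _ _ (Submodule.sum_mem _ fun k _ =>
      Fock.tmul_mem_degreeLT (skewDeriv_mem_degreeLT _ _ _ hp) _))

/-- The leading part of the operator of `z_i`. -/
noncomputable def zLead (i : Fin n) : Module.End ℂ (Fock n) :=
  -(xiOp i * Fock.map (SkewPoly.parity n).toLinearMap (fnCliff i))

theorem zLead_tmul (i : Fin n) (p v) :
    zLead i (Fock.tmul p v) = -Fock.tmul (X i * SkewPoly.parity n p) (fnCliff i v) := by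
  simp [zLead, Fock.map_tmul, xiOp_tmul]

theorem zLead_mem_degreeLT (i : Fin n) {d : ℕ} {x : Fock n} (hx : x ∈ Fock.degreeLT n d) :
    zLead i x ∈ Fock.degreeLT n (d + 1) := by
  refine Fock.map_mem_of_mem_degreeLT _ _ (fun p hp v => ?_) hx
  rw [zLead_tmul]
  exact Submodule.neg_mem _
    (Fock.tmul_mem_degreeLT (X_mul_mem_degreeLT i (parity_mem_degreeLT hp)) _)

/-- What remains of z_i is ξ_i after a degree-lowering operator, plus transpositions, neither of
which raises the degree. -/
theorem fockRep_z_sub_zLead_mem_degreeLT (i : Fin n) {d : ℕ} {x : Fock n}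
    (hx : x ∈ Fock.degreeLT n (d + 1)) :
    fockRep t u (z t u i) x - zLead i x ∈ Fock.degreeLT n (d + 1) := by
  have : fockRep t u (z t u i) x - zLead i x = -xiOp i (etaLower t u i x) +
      u • ∑ k ∈ Finset.univ.filter (fun k => k < i), permOp (Equiv.swap k i) x := by
    rw [z_eq, jucysMurphy]
    simp only [map_add, map_neg, map_smul, map_sum, map_mul, fockRep_perm, fockRep_xi, fockRep_eta,
      etaOp, zLead, LinearMap.add_apply, LinearMap.neg_apply, LinearMap.smul_apply,
      LinearMap.sum_apply, Module.End.mul_apply]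
    abel
  rw [this]
  exact Submodule.add_mem _
    (Submodule.neg_mem _ (xiOp_mem_degreeLT i (etaLower_mem_degreeLT t u i hx)))
    (Submodule.smul_mem _ _ (Submodule.sum_mem _ fun k _ => permOp_mem_degreeLT _ hx))

theorem fockRep_z_mem_degreeLT (i : Fin n) {d : ℕ} {x : Fock n} (hx : x ∈ Fock.degreeLT n d) :
    fockRep t u (z t u i) x ∈ Fock.degreeLT n (d + 1) := by
  rw [← sub_add_cancel (fockRep t u (z t u i) x) (zLead i x)]
  exact Submodule.add_mem _
    (fockRep_z_sub_zLead_mem_degreeLT t u i (Fock.degreeLT_mono d.le_succ hx))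
    (zLead_mem_degreeLT i hx)

/-- Leading term of a product of `z_i` applied to a vacuum vector. -/
theorem exists_fockRep_listProd_z (l : List (Fin n)) :
    ∃ s : ℂ, s ≠ 0 ∧ ∀ v, fockRep t u (l.map (z t u)).prod (Fock.tmul 1 v) -
      s • Fock.tmul (listProd l) ((l.map fnCliff).prod v) ∈ Fock.degreeLT n l.length := by
  induction l with
  | nil => exact ⟨1, one_ne_zero, fun v => by simp⟩
  | cons i l ih =>
    obtain ⟨s, hs, h⟩ := ih
    -- The minus sign comes from z_i = -ξ_i η_i + ..., the power of -1 from the parity of `listProd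
    -- l`.
    refine ⟨-(s * (-1) ^ l.length), neg_ne_zero.2 (mul_ne_zero hs (by simp)), fun v => ?_⟩
    set y := fockRep t u (l.map (z t u)).prod (Fock.tmul 1 v) with hy
    set w := (l.map fnCliff).prod v with hw
    have e1 : fockRep t u ((i :: l).map (z t u)).prod (Fock.tmul 1 v) = fockRep t u (z t u i) y := by
      rw [List.map_cons, List.prod_cons, map_mul, Module.End.mul_apply]
    have e2 : ((i :: l).map fnCliff).prod v = fnCliff i w := by
      rw [List.map_cons, List.prod_cons, Module.End.mul_apply]
    have e3 : -(s * (-1) ^ l.length) • Fock.tmul (listProd (i :: l)) (fnCliff i w) =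
        zLead i (s • Fock.tmul (listProd l) w) := by
      rw [map_smul, zLead_tmul, parity_listProd, mul_smul_comm, map_smul, LinearMap.smul_apply,
        listProd_cons, neg_smul, mul_smul, smul_neg]
    rw [e1, e2, e3]
    have hlead : s • Fock.tmul (listProd l) w ∈ Fock.degreeLT n (l.length + 1) :=
      Submodule.smul_mem _ _ (Fock.tmul_mem_degreeLT (listProd_mem_degreeLT (by simp)) _)
    have e4 : fockRep t u (z t u i) y - zLead i (s • Fock.tmul (listProd l) w) =
        fockRep t u (z t u i) (y - s • Fock.tmul (listProd l) w) +
          (fockRep t u (z t u i) (s • Fock.tmul (listProd l) w) -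
            zLead i (s • Fock.tmul (listProd l) w)) := by
      rw [map_sub]
      abel
    rw [e4]
    exact Submodule.add_mem _ (fockRep_z_mem_degreeLT t u i (h v))
      (fockRep_z_sub_zLead_mem_degreeLT t u i hlead)

theorem listProd_fnCliff_apply (l : List (Fin n)) (v) (g : Equiv.Perm (Fin n)) :
    (l.map fnCliff).prod v g = (l.map fun i => cliff (g⁻¹ i)).prod * v g := by
  induction l with
  | nil => simp
  | cons i l ih =>
    rw [List.map_cons, List.prod_cons, Module.End.mul_apply, fnCliff_apply, ih, List.map_cons,
      List.prod_cons, mul_assoc]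

theorem isUnit_listProd_cliff (f : Fin n → Fin n) (l : List (Fin n)) :
    IsUnit (l.map fun i => cliff (f i)).prod := by
  induction l with
  | nil => simp
  | cons i l ih =>
    rw [List.map_cons, List.prod_cons]
    exact (isUnit_cliff _).mul ih

/-- The monomial in the commuting elements `z_i` attached to a multiset. -/
noncomputable def zMonomial (m : Multiset (Fin n)) : OddDaHa n t u := (m.toList.map (z t u)).prod

/-- The vacuum vector `1 ⊗ δ_1`. -/
noncomputable def vacuum (n : ℕ) : Fock n := Fock.tmul 1 (Pi.single 1 1)

/-- The remainder has degree below `m.card`, so only the leading term could contribute; it has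
monomial `m` and is supported at `σ`. -/
theorem coeff_fockRep_zMonomial_mul_perm {a m : Multiset (Fin n)} (h : m.card ≤ a.card)
    (g σ : Equiv.Perm (Fin n)) :
    (m, σ) ≠ (a, g) →
      Fock.coeff a g (fockRep t u (zMonomial t u m * perm t u σ) (vacuum n)) = 0 := by
  intro hne
  obtain ⟨s, -, hs⟩ := exists_fockRep_listProd_z t u m.toList
  have hs := Fock.coeff_eq_zero (a := a) g (by simpa using h) (hs (fnPerm σ (Pi.single 1 1)))
  rw [map_sub, sub_eq_zero] at hs
  rw [map_mul, Module.End.mul_apply, fockRep_perm, vacuum, permOp_one_tmul, zMonomial, hs, map_smul,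
    Fock.coeff_tmul, cliffordCoeff_listProd, listProd_fnCliff_apply, fnPerm_apply,
    Multiset.coe_toList]
  by_cases hm : m = a
  · have hσ : σ⁻¹ * g ≠ 1 := by
      rw [Ne, inv_mul_eq_one]
      rintro rfl
      exact hne (by rw [hm])
    rw [Pi.single_eq_of_ne hσ, mul_zero, mul_zero, smul_zero]
  · rw [if_neg hm, zero_mul, smul_zero]

theorem coeff_fockRep_zMonomial_mul_perm_self (a : Multiset (Fin n)) (g : Equiv.Perm (Fin n)) :
    Fock.coeff a g (fockRep t u (zMonomial t u a * perm t u g) (vacuum n)) ≠ 0 := by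
  obtain ⟨s, hs0, hs⟩ := exists_fockRep_listProd_z t u a.toList
  have hs := Fock.coeff_eq_zero (a := a) g (by simp) (hs (fnPerm g (Pi.single 1 1)))
  rw [map_sub, sub_eq_zero] at hs
  rw [map_mul, Module.End.mul_apply, fockRep_perm, vacuum, permOp_one_tmul, zMonomial, hs, map_smul,
    Fock.coeff_tmul, cliffordCoeff_listProd, listProd_fnCliff_apply, fnPerm_apply,
    Multiset.coe_toList, if_pos rfl, inv_mul_cancel, Pi.single_eq_same, mul_one]
  exact smul_ne_zero hs0
    ((isUnit_listProd_cliff id a.toList).mul (isUnit_listProd_cliff (g⁻¹ : Equiv.Perm _) _)).ne_zero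

theorem linearIndependent_zMonomial_mul_perm :
    LinearIndependent ℂ fun x : Multiset (Fin n) × Equiv.Perm (Fin n) =>
      zMonomial t u x.1 * perm t u x.2 := by
  rw [linearIndependent_iff]
  intro F hF
  by_contra hne
  -- In a relation, a term of maximal degree is isolated by its own coefficient functional: all
  -- other terms of the support contribute zero there.
  obtain ⟨⟨a, g⟩, hag, hmax⟩ := Finset.exists_max_image F.support (fun x => x.1.card)
    (Finsupp.support_nonempty_iff.2 hne)
  have h := congrArg (fun w => Fock.coeff a g (fockRep t u w (vacuum n))) hF
  simp only [Finsupp.linearCombination_apply, Finsupp.sum, map_sum, map_smul, LinearMap.sum_apply,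
    LinearMap.smul_apply, map_zero, LinearMap.zero_apply] at h
  rw [Finset.sum_eq_single_of_mem _ hag fun x hx hxa => by
    rw [coeff_fockRep_zMonomial_mul_perm t u (hmax x hx) g x.2 hxa, smul_zero]] at h
  exact smul_ne_zero (Finsupp.mem_support_iff.1 hag)
    (coeff_fockRep_zMonomial_mul_perm_self t u a g) h

end OddDaHa


/-! ### The degenerate affine Hecke algebra -/

namespace DegAffHecke

variable {n : ℕ} (u : ℂ)

theorem perm_one : perm u (1 : Equiv.Perm (Fin n)) = 1 := by
  simpa [perm] using RingQuot.mkAlgHom_rel ℂ (DegAffHeckeRel.perm_one (n := n) (u := u))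

theorem perm_mul (σ τ : Equiv.Perm (Fin n)) : perm u (σ * τ) = perm u σ * perm u τ := by
  simpa [perm] using RingQuot.mkAlgHom_rel ℂ (DegAffHeckeRel.perm_mul (u := u) σ τ)

theorem x_mul_x (i j : Fin n) : x u i * x u j = x u j * x u i := by
  simpa [x] using RingQuot.mkAlgHom_rel ℂ (DegAffHeckeRel.x_x (u := u) i j)

/-- The monomial in the commuting generators `x_i` attached to a multiset. -/
noncomputable def xMonomial (m : Multiset (Fin n)) : DegAffHecke n u := (m.toList.map (x u)).prod

theorem xMonomial_coe (l : List (Fin n)) : xMonomial u (l : Multiset (Fin n)) = (l.map (x u)).prod := by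
  have hp : ((l : Multiset (Fin n)).toList.map (x u)).Perm (l.map (x u)) :=
    (Multiset.coe_eq_coe.1 (Multiset.coe_toList _)).map _
  refine hp.prod_eq' ?_
  rw [List.pairwise_map]
  exact List.pairwise_of_forall fun i j => x_mul_x u i j

theorem x_mul_xMonomial (i : Fin n) (m : Multiset (Fin n)) :
    x u i * xMonomial u m = xMonomial u (i ::ₘ m) := by
  induction m using Quotient.inductionOn with
  | _ l =>
    rw [Multiset.quot_mk_to_coe, xMonomial_coe, Multiset.cons_coe, xMonomial_coe, List.map_cons,
      List.prod_cons]

/-- The span of the standard monomials `x^m σ`. -/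
noncomputable def standardSpan (n : ℕ) (u : ℂ) : Submodule ℂ (DegAffHecke n u) :=
  Submodule.span ℂ (Set.range fun p : Multiset (Fin n) × Equiv.Perm (Fin n) =>
    xMonomial u p.1 * perm u p.2)

theorem xMonomial_mul_perm_mem (m : Multiset (Fin n)) (σ : Equiv.Perm (Fin n)) :
    xMonomial u m * perm u σ ∈ standardSpan n u :=
  Submodule.subset_span ⟨(m, σ), rfl⟩

theorem mul_mem_standardSpan {a : DegAffHecke n u}
    (h : ∀ m σ, a * (xMonomial u m * perm u σ) ∈ standardSpan n u) {b : DegAffHecke n u}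
    (hb : b ∈ standardSpan n u) : a * b ∈ standardSpan n u := by
  have : standardSpan n u ≤ (standardSpan n u).comap (LinearMap.mulLeft ℂ a) := by
    conv_lhs => rw [standardSpan]
    rw [Submodule.span_le]
    rintro _ ⟨⟨m, σ⟩, rfl⟩
    exact h m σ
  exact this hb

theorem x_mul_mem_standardSpan (i : Fin n) {b : DegAffHecke n u} (hb : b ∈ standardSpan n u) :
    x u i * b ∈ standardSpan n u := by
  refine mul_mem_standardSpan u (fun m σ => ?_) hb
  rw [← mul_assoc, x_mul_xMonomial]
  exact xMonomial_mul_perm_mem u _ _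

/-- Moving a simple reflection past a generator. -/
theorem exists_simple_mul_x {i j : Fin n} (hij : j.val = i.val + 1) (k : Fin n) :
    ∃ c : ℂ, perm u (Equiv.swap i j) * x u k =
      x u (Equiv.swap i j k) * perm u (Equiv.swap i j) + c • 1 := by
  have h1 : perm u (Equiv.swap i j) * x u i =
      x u j * perm u (Equiv.swap i j) + (-u) • 1 := by
    have h := RingQuot.mkAlgHom_rel ℂ (DegAffHeckeRel.simple_x (u := u) i j hij)
    rw [sub_eq_add_neg, ← neg_smul, map_add, map_smul, map_mul, map_mul, map_one] at h
    exact h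
  rcases eq_or_ne k i with rfl | hki
  · exact ⟨-u, by rw [Equiv.swap_apply_left, h1]⟩
  rcases eq_or_ne k j with rfl | hkj
  · refine ⟨u, ?_⟩
    have hss : perm u (Equiv.swap i k) * perm u (Equiv.swap i k) = 1 := by
      rw [← perm_mul, Equiv.swap_mul_self, perm_one]
    -- Multiplying the relation for x_i by s on both sides gives the relation for x_{i+1}, with the
    -- opposite constant.
    have h2 := congrArg (fun a => perm u (Equiv.swap i k) * a * perm u (Equiv.swap i k)) h1
    simp only [mul_add, add_mul, mul_assoc, hss, mul_one, mul_smul_comm, smul_mul_assoc] at h2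
    rw [← mul_assoc, hss, one_mul] at h2
    rw [Equiv.swap_apply_right, h2, add_assoc, ← add_smul, neg_add_cancel, zero_smul, add_zero]
  · refine ⟨0, ?_⟩
    have h := RingQuot.mkAlgHom_rel ℂ (DegAffHeckeRel.simple_x_of_ne (u := u) i j k hij hki hkj)
    rw [map_mul, map_mul] at h
    rw [Equiv.swap_apply_of_ne_of_ne hki hkj, zero_smul, add_zero]
    exact h

theorem simple_mul_mem_standardSpan {i j : Fin n} (hij : j.val = i.val + 1)
    {b : DegAffHecke n u} (hb : b ∈ standardSpan n u) :
    perm u (Equiv.swap i j) * b ∈ standardSpan n u := by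
  refine mul_mem_standardSpan u (fun m σ => ?_) hb
  induction m using Multiset.induction with
  | empty =>
    have : xMonomial u (0 : Multiset (Fin n)) = 1 := by simp [xMonomial]
    rw [this, one_mul, ← perm_mul, ← one_mul (perm u _), ← this]
    exact xMonomial_mul_perm_mem u _ _
  | cons k m ih =>
    obtain ⟨c, hc⟩ := exists_simple_mul_x u hij k
    rw [← x_mul_xMonomial, mul_assoc, ← mul_assoc, hc, add_mul, mul_assoc, smul_mul_assoc, one_mul]
    exact Submodule.add_mem _ (x_mul_mem_standardSpan u _ ih)
      (Submodule.smul_mem _ _ (xMonomial_mul_perm_mem u _ _))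

theorem perm_mul_mem_standardSpan (σ : Equiv.Perm (Fin n)) {b : DegAffHecke n u}
    (hb : b ∈ standardSpan n u) : perm u σ * b ∈ standardSpan n u := by
  rcases n with _ | n
  -- The case n = 0 is separate because adjacent transpositions are indexed through `Fin (n + 1)`.
  · rwa [Subsingleton.elim σ 1, perm_one, one_mul]
  have hσ : σ ∈ Submonoid.closure
      (Set.range fun i : Fin n => Equiv.swap i.castSucc i.succ) := by
    rw [Equiv.Perm.mclosure_swap_castSucc_succ]
    trivial
  induction hσ using Submonoid.closure_induction generalizing b with
  | mem σ h =>
    obtain ⟨i, rfl⟩ := h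
    exact simple_mul_mem_standardSpan u (by simp) hb
  | one => rwa [perm_one, one_mul]
  | mul σ τ _ _ ihσ ihτ =>
    rw [perm_mul, mul_assoc]
    exact ihσ (ihτ hb)

/-- A property of elements that holds for scalars and generators and is stable under sums and
products holds everywhere. -/
theorem induction {C : DegAffHecke n u → Prop} (algebraMap : ∀ r, C (algebraMap ℂ _ r))
    (x : ∀ i, C (x u i)) (perm : ∀ σ, C (perm u σ)) (mul : ∀ a b, C a → C b → C (a * b))
    (add : ∀ a b, C a → C b → C (a + b)) (a : DegAffHecke n u) : C a := by
  obtain ⟨a, rfl⟩ := RingQuot.mkAlgHom_surjective ℂ (DegAffHeckeRel n u) a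
  induction a using FreeAlgebra.induction with
  | grade0 r =>
    rw [AlgHom.commutes]
    exact algebraMap r
  | grade1 g =>
    cases g with
    | x i => exact x i
    | perm σ => exact perm σ
  | mul a b ha hb =>
    rw [map_mul]
    exact mul _ _ ha hb
  | add a b ha hb =>
    rw [map_add]
    exact add _ _ ha hb

theorem standardSpan_eq_top : standardSpan n u = ⊤ := by
  have key : ∀ a : DegAffHecke n u, ∀ b ∈ standardSpan n u, a * b ∈ standardSpan n u := by
    intro a
    induction a using induction with
    | algebraMap r =>
      intro b hb
      rw [← Algebra.smul_def]
      exact Submodule.smul_mem _ r hb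
    | x i => exact fun b => x_mul_mem_standardSpan u i
    | perm σ => exact fun b => perm_mul_mem_standardSpan u σ
    | mul a b ha hb =>
      intro c hc
      rw [mul_assoc]
      exact ha _ (hb _ hc)
    | add a b ha hb =>
      intro c hc
      rw [add_mul]
      exact Submodule.add_mem _ (ha _ hc) (hb _ hc)
  rw [eq_top_iff]
  rintro a -
  have h1 : (1 : DegAffHecke n u) ∈ standardSpan n u := by
    simpa [xMonomial, perm_one] using xMonomial_mul_perm_mem u (0 : Multiset (Fin n)) 1
  simpa using key a 1 h1

/-! ### The comparison homomorphism, its injectivity and its image. -/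

open DegAffHeckeGen in
/-- The homomorphism to the odd double affine Hecke algebra with `x_i ↦ z_i` and `σ ↦ σ`. -/
noncomputable def toOddDaHa (n : ℕ) (t u : ℂ) : DegAffHecke n u →ₐ[ℂ] OddDaHa n t u :=
  RingQuot.liftAlgHom ℂ ⟨FreeAlgebra.lift ℂ fun
    | .x i => OddDaHa.z t u i
    | .perm σ => OddDaHa.perm t u σ, by
    intro a b hab
    cases hab with
    | perm_one => simpa using OddDaHa.perm_one t u
    | perm_mul σ τ => simpa using OddDaHa.perm_mul t u σ τ
    | x_x i j => simpa using OddDaHa.z_mul_z t u i j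
    | simple_x i j hij => simpa using OddDaHa.simple_mul_z t u hij
    | simple_x_of_ne i j k hij hi hj => simpa using OddDaHa.simple_mul_z_of_ne t u hij hi hj⟩

theorem toOddDaHa_x (t : ℂ) (i : Fin n) : toOddDaHa n t u (x u i) = OddDaHa.z t u i := by
  simp [toOddDaHa, x]

theorem toOddDaHa_perm (t : ℂ) (σ : Equiv.Perm (Fin n)) :
    toOddDaHa n t u (perm u σ) = OddDaHa.perm t u σ := by
  simp [toOddDaHa, perm]

theorem toOddDaHa_xMonomial (t : ℂ) (m : Multiset (Fin n)) :
    toOddDaHa n t u (xMonomial u m) = OddDaHa.zMonomial t u m := by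
  rw [xMonomial, OddDaHa.zMonomial, map_list_prod, List.map_map]
  congr 2
  funext i
  exact toOddDaHa_x u t i

/-- A spanning family with linearly independent image forces injectivity, and no independence in the
Hecke algebra has to be known beforehand. -/
theorem toOddDaHa_injective (t : ℂ) : Function.Injective (toOddDaHa n t u) := by
  have hspan : ∀ a : DegAffHecke n u, ∃ F, Finsupp.linearCombination ℂ
      (fun p : Multiset (Fin n) × Equiv.Perm (Fin n) => xMonomial u p.1 * perm u p.2) F = a := by
    intro a
    have ha : a ∈ standardSpan n u := by
      rw [standardSpan_eq_top]
      trivial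
    exact (Finsupp.mem_span_range_iff_exists_finsupp.1 ha)
  have hmap : ∀ F, toOddDaHa n t u (Finsupp.linearCombination ℂ
      (fun p : Multiset (Fin n) × Equiv.Perm (Fin n) => xMonomial u p.1 * perm u p.2) F) =
      Finsupp.linearCombination ℂ (fun p : Multiset (Fin n) × Equiv.Perm (Fin n) =>
        OddDaHa.zMonomial t u p.1 * OddDaHa.perm t u p.2) F := by
    intro F
    simp only [Finsupp.linearCombination_apply, Finsupp.sum, map_sum, map_smul, map_mul,
      toOddDaHa_xMonomial, toOddDaHa_perm]
  intro a b hab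
  obtain ⟨F, rfl⟩ := hspan a
  obtain ⟨G, rfl⟩ := hspan b
  rw [hmap, hmap] at hab
  rw [OddDaHa.linearIndependent_zMonomial_mul_perm t u hab]

theorem range_toOddDaHa (t : ℂ) : (toOddDaHa n t u).range =
    Algebra.adjoin ℂ (Set.range (OddDaHa.z (n := n) t u) ∪
      Set.range (OddDaHa.perm (n := n) t u)) := by
  apply le_antisymm
  · rintro _ ⟨a, rfl⟩
    change toOddDaHa n t u a ∈ _
    induction a using induction with
    | algebraMap r =>
      rw [AlgHom.commutes]
      exact Subalgebra.algebraMap_mem _ r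
    | x i =>
      rw [toOddDaHa_x]
      exact Algebra.subset_adjoin (Or.inl ⟨i, rfl⟩)
    | perm σ =>
      rw [toOddDaHa_perm]
      exact Algebra.subset_adjoin (Or.inr ⟨σ, rfl⟩)
    | mul a b ha hb =>
      rw [map_mul]
      exact Subalgebra.mul_mem _ ha hb
    | add a b ha hb =>
      rw [map_add]
      exact Subalgebra.add_mem _ ha hb
  · rw [Algebra.adjoin_le_iff]
    rintro _ (⟨i, rfl⟩ | ⟨σ, rfl⟩)
    · exact ⟨x u i, toOddDaHa_x u t i⟩
    · exact ⟨perm u σ, toOddDaHa_perm u t σ⟩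

end DegAffHecke

theorem mainTheorem12 (n : ℕ) (t u : ℂ) :
    (∀ i j : Fin n, OddDaHa.z t u i * OddDaHa.z t u j = OddDaHa.z t u j * OddDaHa.z t u i) ∧
    (∀ i j : Fin n, j.val = i.val + 1 →
      OddDaHa.perm t u (Equiv.swap i j) * OddDaHa.z t u i =
        OddDaHa.z t u j * OddDaHa.perm t u (Equiv.swap i j) - u • 1) ∧
    (∀ i j k : Fin n, j.val = i.val + 1 → k ≠ i → k ≠ j →
      OddDaHa.perm t u (Equiv.swap i j) * OddDaHa.z t u k =
        OddDaHa.z t u k * OddDaHa.perm t u (Equiv.swap i j)) ∧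
    (∃ e : DegAffHecke n u ≃ₐ[ℂ]
        Algebra.adjoin ℂ (Set.range (OddDaHa.z (n := n) t u) ∪
          Set.range (OddDaHa.perm (n := n) t u)),
      (∀ i : Fin n, (e (DegAffHecke.x u i) : OddDaHa n t u) = OddDaHa.z t u i) ∧
      (∀ σ : Equiv.Perm (Fin n),
        (e (DegAffHecke.perm u σ) : OddDaHa n t u) = OddDaHa.perm t u σ)) := by
  refine ⟨OddDaHa.z_mul_z t u, fun i j hij => OddDaHa.simple_mul_z t u hij,
    fun i j k hij hi hj => OddDaHa.simple_mul_z_of_ne t u hij hi hj,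
    (AlgEquiv.ofInjective _ (DegAffHecke.toOddDaHa_injective u t)).trans
      (Subalgebra.equivOfEq _ _ (DegAffHecke.range_toOddDaHa u t)), fun i => ?_, fun σ => ?_⟩
  · exact DegAffHecke.toOddDaHa_x u t i
  · exact DegAffHecke.toOddDaHa_perm u t σ
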